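/- Let $K,M$ be integers with $1\le M\le K-1$. For a prime power $q$ and an integer $l\ge 1$, let $X_1,\dots,X_K$ (the messages held by a server) be independent and uniform on $\mathbb F_{q^l}$, so that each has entropy $L=l\log_2 q$. Let $S$ be uniform over the $M$-subsets of $\{1,\dots,K\}$ and let $C$ be uniform over the length-$M$ sequences of elements of $\mathbb F_q^\times$, independent of $S$. Given $(S,C)$, let the demand index $W$ be uniform on $\{1,\dots,K\}\setminus S$. The messages are independent of $(W,S,C)$. The user wants $X_W$ and knows $W,S,C$ and the coded side information $Y=\sum_{i\in S}c_iX_i$, where $C=(c_i)_{i\in S}$. A protocol consists of a (discrete, possibly random) query $Q$ that is a stochastic function of $(W,S,C)$ and is generated independently of the messages, and of an answer $A$ that is a deterministic function of $Q$ and $X_1,\dots,X_K$. It is a PIR-CSI--I protocol if (a) ($W$-privacy) $\mathbb P(W=w\mid Q=Q_0)=\mathbb P(W=w)$ for all $w\in\{1,\dots,K\}$ and all queries $Q_0$ of positive probability; (b) (recoverability) $H(X_W\mid A,Q,Y,W,S,C)=0$. It is scalar-linear if, for every query, the answer consists of finitely many linear combinations of $X_1,\dots,X_K$ with coefficients in $\mathbb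 F_q$. Its rate is $L/H(A)$. The capacity (respectively scalar-linear capacity) of the PIR-CSI--I setting is the supremum of the rates over all PIR-CSI--I protocols (respectively all scalar-linear PIR-CSI--I protocols) and over all prime powers $q$ and all $l\ge 1$. Then, for all $1\le M\le K-1$, the capacity and the scalar-linear capacity of the PIR-CSI--I setting are both equal to $\left\lceil \frac{K}{M+1}\right\rceil^{-1}$. -/

import Mathlib

open scoped ENNReal

noncomputable section

namespace PIR

/-! ### Discrete probability and Shannon entropy (in bits) -/

/-- The uniform distribution on a nonempty finite type. -/
def uniform (α : Type) [Finite α] [Nonempty α] : PMF α :=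
  haveI := Fintype.ofFinite α
  PMF.uniformOfFintype α

/-- The contribution `- t log₂ t` of an atom of probability `t` to the Shannon entropy, in bits. -/
def entropyTerm (t : ℝ≥0∞) : ℝ≥0∞ :=
  ENNReal.ofReal (Real.negMulLog t.toReal / Real.log 2)

/-- The Shannon entropy `H(U)`, in bits, of a discrete random variable `U` on `(Ω, p)`.  It takes
values in `[0, ∞]`, so that random variables with infinite entropy are treated correctly. -/
def entropy {Ω α : Type} (p : PMF Ω) (U : Ω → α) : ℝ≥0∞ :=
  ∑' u, entropyTerm (p.map U u)

/-- The conditional Shannon entropy `H(U | V) = ∑ᵥ P(V = v) H(U | V = v)`, in bits. -/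
def condEntropy {Ω α β : Type} (p : PMF Ω) (U : Ω → α) (V : Ω → β) : ℝ≥0∞ :=
  ∑' v, p.map V v *
    ∑' u, entropyTerm (p.map (fun ω => (U ω, V ω)) (u, v) / p.map V v)

/-! ### Demand, support and coefficients of the coded side information -/

/-- The `M`-subsets of the index set `{1, …, K}` of the messages. -/
abbrev Support (K M : ℕ) : Type := {S : Finset (Fin K) // S.card = M}

/-- The length-`M` sequences of nonzero elements of the base field `F`. -/
abbrev Coeffs (F : Type) [Field F] (M : ℕ) : Type := Fin M → Fˣ

/-- The coded side information `Y = c_{i₁} X_{i₁} + ⋯ + c_{i_M} X_{i_M}`, where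
`S = {i₁ < ⋯ < i_M}`. -/
def sideInfo {F E : Type} [Field F] [Field E] [Algebra F E] {K M : ℕ}
    (S : Support K M) (C : Coeffs F M) (X : Fin K → E) : E :=
  ∑ j : Fin M, (C j : F) • X (S.1.orderEmbOfFin S.2 j)

theorem support_nonempty {K M : ℕ} (h : M < K) : Nonempty (Support K M) := by
  obtain ⟨S, -, hS⟩ := Finset.exists_subset_card_eq
    (s := (Finset.univ : Finset (Fin K))) (n := M) (by simpa using h.le)
  exact ⟨⟨S, hS⟩⟩

theorem compl_nonempty {K M : ℕ} (h : M < K) (S : Support K M) : (S.1ᶜ).Nonempty := by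
  rw [← Finset.card_pos, Finset.card_compl, S.2, Fintype.card_fin]
  exact Nat.sub_pos_of_lt h

/-! ### Protocols -/

/-- A query/answer scheme for `K` messages in `E`, with side information of support size `M` and
coefficients in the base field `F`.  The query is a stochastic function of the demand index, the
support and the coefficients; the answer is a deterministic function of the query and of the
messages.  (In Model I the indicator of `W ∈ S` is constantly `0`, so the answer does not need it
as an argument.)  The query and answer alphabets are arbitrary. -/
structure Protocol (F E : Type) [Field F] (K M : ℕ) where
  Query : Type
  Answer : Type
  query : Fin K → Support K M → Coeffs F M → PMF Query
  answer : Query → (Fin K → E) → Answer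

/-- An outcome of the experiment: demand index, support, coefficients, query, messages. -/
structure Outcome (F E : Type) [Field F] (K M : ℕ) (Query : Type) where
  W : Fin K
  S : Support K M
  C : Coeffs F M
  Q : Query
  X : Fin K → E

namespace Protocol

variable {F E : Type} [Field F] [Finite F] [Field E] [Finite E] [Algebra F E] {K M : ℕ}

/-- The joint law in Model I: `S` and `C` are independent and uniform; given them, `W` is uniform
on the complement of `S`; the query is then drawn by the protocol; and the messages are independent
and uniform on `E`, independently of everything else. -/
def law (P : Protocol F E K M) (h : M < K) : PMF (Outcome F E K M P.Query) :=
  haveI := support_nonempty h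
  (uniform (Support K M)).bind fun S =>
  (uniform (Coeffs F M)).bind fun C =>
  (PMF.uniformOfFinset (S.1ᶜ) (compl_nonempty h S)).bind fun W =>
  (P.query W S C).bind fun Q =>
  (uniform (Fin K → E)).bind fun X =>
  PMF.pure ⟨W, S, C, Q, X⟩

/-- `W`-privacy: `P(W = w | Q = q) = P(W = w)` for every query `q` that can occur and every
index `w`. -/
def WPrivate (P : Protocol F E K M) (h : M < K) : Prop :=
  ∀ q ∈ ((P.law h).map Outcome.Q).support, ∀ w : Fin K,
    (P.law h).map (fun ω => (ω.W, ω.Q)) (w, q) / (P.law h).map Outcome.Q q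
      = (P.law h).map Outcome.W w

/-- Recoverability: `H(X_W | A, Q, Y, W, S, C) = 0`. -/
def Recoverable (P : Protocol F E K M) (h : M < K) : Prop :=
  condEntropy (P.law h) (fun ω => ω.X ω.W)
    (fun ω => (P.answer ω.Q ω.X, ω.Q, sideInfo ω.S ω.C ω.X, ω.W, ω.S, ω.C)) = 0

/-- A PIR-CSI--I protocol is one that satisfies `W`-privacy and recoverability in Model I. -/
def IsPIRCSI (P : Protocol F E K M) (h : M < K) : Prop :=
  P.WPrivate h ∧ P.Recoverable h

/-- A protocol is scalar-linear if for every query the answer consists of finitely many linear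
combinations of the messages with coefficients in the base field `F`; answers are identified with
finite sequences in `E` through the relabelling `e`, which loses no information. -/
def ScalarLinear (P : Protocol F E K M) : Prop :=
  ∃ e : P.Answer → List E,
    Set.InjOn e {a | ∃ Q X, P.answer Q X = a} ∧
    ∀ Q, ∃ G : List (Fin K → F), ∀ X,
      e (P.answer Q X) = G.map fun g => ∑ j, g j • X j

/-- The rate `L / H(A)` with `L = l log₂ q`, where `q` is the size of the base field and `l` is the
degree of the extension. -/
def rate (P : Protocol F E K M) (h : M < K) : ℝ≥0∞ :=
  ENNReal.ofReal (Module.finrank F E * Real.logb 2 (Nat.card F)) /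
    entropy (P.law h) (fun ω => P.answer ω.Q ω.X)

end Protocol

/-! ### Capacities -/

/-- The capacity of the PIR-CSI--I setting: the supremum of the rates over all finite base fields
`F`, all finite extensions `E` of `F`, and all PIR-CSI--I protocols. -/
def capacity {K M : ℕ} (h : M < K) : ℝ≥0∞ :=
  sSup {r | ∃ (F E : Type) (_ : Field F) (_ : Finite F) (_ : Field E) (_ : Finite E)
    (_ : Algebra F E) (P : Protocol F E K M), P.IsPIRCSI h ∧ r = P.rate h}

/-- The scalar-linear capacity of the PIR-CSI--I setting: the same supremum over the scalar-linear
PIR-CSI--I protocols. -/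
def scalarLinearCapacity {K M : ℕ} (h : M < K) : ℝ≥0∞ :=
  sSup {r | ∃ (F E : Type) (_ : Field F) (_ : Finite F) (_ : Field E) (_ : Finite E)
    (_ : Algebra F E) (P : Protocol F E K M),
    P.IsPIRCSI h ∧ P.ScalarLinear ∧ r = P.rate h}

end PIR

end

/-! Put `n = ⌈K / (M + 1)⌉`. Converse: fix a query that can occur. By privacy every index `w` is a
possible demand for it, with some support `S` avoiding `w`; by recoverability the answer and the
messages in `S` then determine `X w`. A greedy choice (`exists_determined_indices`) yields `n`
coordinates that, for a fixed answer, are determined by the remaining `K - n`. So each answer has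
probability at most `|E| ^ (-n)`, given any query and hence on average, and the entropy of the
answer is at least `n * L`.

Achievability: over the field with two elements the side information is a plain sum. Cover the
indices by `n` sets of size `M + 1`, overlapping if necessary, and assign to each index a set
containing it. The user relabels the cover at random so that the set assigned to `W` becomes `{W} ∪
S`, and the server returns the `n` sums. Given `w` and a relabelling, exactly one `S` is compatible;
given `w ∉ S`, the number of compatible relabellings is constant by symmetry. Hence demand and query
are independent, and the answer has at most `n` bits. -/

namespace PIR

/-! ### Atoms and Shannon entropy of discrete laws -/

section DiscreteProbability

theorem bind_apply_le {α β : Type} (p : PMF α) (f : α → PMF β) (b : β) (c : ℝ≥0∞)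
    (h : ∀ a ∈ p.support, f a b ≤ c) : p.bind f b ≤ c := by
  rw [PMF.bind_apply]
  calc ∑' a, p a * f a b ≤ ∑' a, p a * c := by
        refine ENNReal.tsum_le_tsum fun a => ?_
        by_cases ha : p a = 0
        · simp [ha]
        · exact mul_le_mul_right (h a ((p.mem_support_iff a).2 ha)) _
    _ = c := by rw [ENNReal.tsum_mul_right, p.tsum_coe, one_mul]

theorem map_pair_add_le {Ω α β : Type} (p : PMF Ω) (U : Ω → α) (V : Ω → β) {u u' : α}
    (huu' : u ≠ u') (v : β) :
    p.map (fun ω => (U ω, V ω)) (u, v) + p.map (fun ω => (U ω, V ω)) (u', v) ≤ p.map V v := by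
  classical
  simp only [PMF.map_apply]
  rw [← ENNReal.tsum_add]
  refine ENNReal.tsum_le_tsum fun ω => ?_
  by_cases hu : u = U ω
  · have hu' : u' ≠ U ω := fun h => huu' (hu.trans h.symm)
    by_cases hv : v = V ω <;> simp [hu, hv, hu']
  · by_cases hv : v = V ω <;> by_cases hu' : u' = U ω <;> simp [hu, hv, hu']

theorem map_pair_le {Ω α β : Type} (p : PMF Ω) (U : Ω → α) (V : Ω → β) (u : α) (v : β) :
    p.map (fun ω => (U ω, V ω)) (u, v) ≤ p.map V v := by
  classical
  simp only [PMF.map_apply]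
  refine ENNReal.tsum_le_tsum fun ω => ?_
  by_cases hu : u = U ω <;> by_cases hv : v = V ω <;> simp [hu, hv]

theorem entropyTerm_zero : entropyTerm 0 = 0 := by simp [entropyTerm]

theorem entropyTerm_one : entropyTerm 1 = 0 := by simp [entropyTerm]

theorem eq_zero_or_one_of_entropyTerm_eq_zero {t : ℝ≥0∞} (ht : t ≤ 1)
    (h : entropyTerm t = 0) : t = 0 ∨ t = 1 := by
  have hfin : t ≠ ∞ := ne_top_of_le_ne_top ENNReal.one_ne_top ht
  by_contra! hne
  have h0 : 0 < t.toReal := ENNReal.toReal_pos hne.1 hfin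
  have h1 : t.toReal < 1 := by
    have := (ENNReal.toReal_lt_toReal hfin ENNReal.one_ne_top).2 (lt_of_le_of_ne ht hne.2)
    simpa using this
  rw [entropyTerm, ENNReal.ofReal_eq_zero] at h
  have : 0 < Real.negMulLog t.toReal / Real.log 2 := by
    refine div_pos ?_ (Real.log_pos one_lt_two)
    rw [Real.negMulLog_eq_neg]
    have := mul_pos_of_neg_of_neg (Real.log_neg h0 h1) (neg_lt_zero.2 h0)
    linarith
  linarith

/-- A discrete random variable has vanishing conditional entropy exactly when it is determined, on
the support, by the conditioning variable. -/
theorem condEntropy_eq_zero_iff {Ω α β : Type} (p : PMF Ω) (U : Ω → α) (V : Ω → β) :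
    condEntropy p U V = 0 ↔
      ∀ ω ∈ p.support, ∀ ω' ∈ p.support, V ω = V ω' → U ω = U ω' := by
  classical
  constructor
  · intro h ω hω ω' hω' hV
    by_contra hU
    have hpair : ∀ η ∈ p.support, p.map (fun ω => (U ω, V ω)) (U η, V η) ≠ 0 := fun η hη =>
      (PMF.mem_support_iff _ _).1 ((PMF.mem_support_map_iff _ _ _).2 ⟨η, hη, rfl⟩)
    have hv : p.map V (V ω) ≠ 0 :=
      (PMF.mem_support_iff _ _).1 ((PMF.mem_support_map_iff _ _ _).2 ⟨ω, hω, rfl⟩)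
    have htop : p.map V (V ω) ≠ ∞ := PMF.apply_ne_top _ _
    have hterm := (mul_eq_zero.1 (ENNReal.tsum_eq_zero.1 h (V ω))).resolve_left hv
    have h1 : p.map (fun ω => (U ω, V ω)) (U ω, V ω) = p.map V (V ω) := by
      rcases eq_zero_or_one_of_entropyTerm_eq_zero
        (ENNReal.div_le_of_le_mul (by rw [one_mul]; exact map_pair_le p U V _ _))
        (ENNReal.tsum_eq_zero.1 hterm (U ω)) with h0 | h1
      · exact absurd ((ENNReal.div_eq_zero_iff.1 h0).resolve_right htop) (hpair ω hω)
      · exact (ENNReal.div_eq_one_iff hv htop).1 h1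
    -- The value `U ω` already carries all the mass of the fibre of `V`, which leaves none for `U
    -- ω'`.
    have h2 := map_pair_add_le p U V hU (V ω)
    rw [h1] at h2
    have h3 : p.map (fun ω => (U ω, V ω)) (U ω', V ω) ≤ 0 :=
      (ENNReal.add_le_add_iff_left htop).1 (by rwa [add_zero])
    rw [hV] at h3
    exact hpair ω' hω' (le_antisymm h3 bot_le)
  · intro h
    refine ENNReal.tsum_eq_zero.2 fun v => ?_
    by_cases hv : p.map V v = 0
    · rw [hv, zero_mul]
    obtain ⟨ω₀, hω₀, rfl⟩ := (PMF.mem_support_map_iff _ _ _).1 ((PMF.mem_support_iff _ _).2 hv)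
    refine mul_eq_zero_of_right _ (ENNReal.tsum_eq_zero.2 fun u => ?_)
    by_cases hu : u = U ω₀
    · have : p.map (fun ω => (U ω, V ω)) (u, V ω₀) = p.map V (V ω₀) := by
        simp only [PMF.map_apply]
        refine tsum_congr fun ω => ?_
        by_cases hω : p ω = 0
        · simp [hω]
        by_cases hV : V ω₀ = V ω
        · simp [hV, hu, h ω₀ hω₀ ω ((p.mem_support_iff _).2 hω) hV]
        · simp [hV]
      rw [this, ENNReal.div_self hv (PMF.apply_ne_top _ _), entropyTerm_one]
    · have : p.map (fun ω => (U ω, V ω)) (u, V ω₀) = 0 := by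
        rw [← not_ne_iff, ← PMF.mem_support_iff, PMF.mem_support_map_iff]
        rintro ⟨ω, hω, he⟩
        rw [Prod.mk.injEq] at he
        exact hu (he.1.symm.trans (h ω hω ω₀ hω₀ he.2))
      rw [this, ENNReal.zero_div, entropyTerm_zero]

/-- If every atom has probability at most `1 / b`, the entropy is at least `log₂ b`. -/
theorem ofReal_logb_le_entropy {Ω α : Type} (p : PMF Ω) (U : Ω → α) {b : ℝ} (hb : 1 ≤ b)
    (h : ∀ u, p.map U u ≤ ENNReal.ofReal b⁻¹) : ENNReal.ofReal (Real.logb 2 b) ≤ entropy p U := by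
  have hb0 : 0 < b := by linarith
  calc ENNReal.ofReal (Real.logb 2 b)
      = ∑' u, p.map U u * ENNReal.ofReal (Real.logb 2 b) := by
        rw [ENNReal.tsum_mul_right, PMF.tsum_coe, one_mul]
    _ ≤ entropy p U := by
        refine ENNReal.tsum_le_tsum fun u => ?_
        have hfin : p.map U u ≠ ∞ := PMF.apply_ne_top _ _
        rw [← ENNReal.ofReal_toReal hfin, ← ENNReal.ofReal_mul ENNReal.toReal_nonneg, entropyTerm,
          ENNReal.ofReal_toReal hfin]
        refine ENNReal.ofReal_le_ofReal ?_
        set t := (p.map U u).toReal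
        have ht : t ≤ b⁻¹ := ENNReal.toReal_le_of_le_ofReal (by positivity) (h u)
        rcases (ENNReal.toReal_nonneg : 0 ≤ t).eq_or_lt with h0 | h0
        · rw [show t = 0 from h0.symm]
          simp
        have hlog : Real.log b ≤ -Real.log t := by
          have := Real.log_le_log h0 ht
          rw [Real.log_inv] at this
          linarith
        rw [Real.logb, ← mul_div_assoc, Real.negMulLog_eq_neg]
        refine div_le_div_of_nonneg_right ?_ (Real.log_pos one_lt_two).le
        have := mul_le_mul_of_nonneg_left hlog h0.le
        linarith

/-- The entropy is at most the logarithm of the size of the alphabet. -/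
theorem entropy_le_logb_card {Ω α : Type} [Fintype α] [Nonempty α] (p : PMF Ω) (U : Ω → α) :
    entropy p U ≤ ENNReal.ofReal (Real.logb 2 (Fintype.card α)) := by
  have hN : (0 : ℝ) < Fintype.card α := by exact_mod_cast Fintype.card_pos
  have hle : ∀ u, (p.map U u).toReal ≤ 1 := fun u => by
    simpa using ENNReal.toReal_mono ENNReal.one_ne_top (PMF.coe_le_one (p.map U) u)
  have hsum : ∑ u, (p.map U u).toReal = 1 := by
    rw [← ENNReal.toReal_sum fun u _ => PMF.apply_ne_top (p.map U) u,
      ← tsum_fintype (L := .unconditional α), PMF.tsum_coe,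
      ENNReal.toReal_one]
  have hlog2 : 0 < Real.log 2 := Real.log_pos one_lt_two
  simp only [entropy, entropyTerm]
  rw [tsum_fintype, ← ENNReal.ofReal_sum_of_nonneg fun u _ =>
    div_nonneg (Real.negMulLog_nonneg ENNReal.toReal_nonneg (hle u)) hlog2.le, ← Finset.sum_div]
  refine ENNReal.ofReal_le_ofReal (div_le_div_of_nonneg_right ?_ hlog2.le)
  -- Jensen's inequality with equal weights: the mean of the `negMulLog` terms is at most
  -- `negMulLog` of the mean probability `1 / |α|`.
  have hJ := Real.concaveOn_negMulLog.le_map_sum (t := Finset.univ)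
    (w := fun _ : α => (Fintype.card α : ℝ)⁻¹) (p := fun u => (p.map U u).toReal)
    (fun _ _ => by positivity) (by simp [hN.ne']) (fun u _ => by simp)
  simp only [smul_eq_mul, ← Finset.mul_sum, hsum, mul_one] at hJ
  rw [Real.negMulLog.eq_1 (Fintype.card α : ℝ)⁻¹, Real.log_inv] at hJ
  rw [inv_mul_le_iff₀ hN] at hJ
  calc _ ≤ _ := hJ
    _ = Real.log (Fintype.card α) := by field_simp

theorem uniform_apply {α : Type} [Fintype α] [Nonempty α] (a : α) :
    uniform α a = (Fintype.card α : ℝ≥0∞)⁻¹ := by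
  have := @PMF.uniformOfFintype_apply α (Fintype.ofFinite α) _ a
  rw [uniform, this]
  congr 2
  exact @Fintype.card_congr α α (Fintype.ofFinite α) _ (Equiv.refl α)

theorem support_uniform {α : Type} [Finite α] [Nonempty α] : (uniform α).support = Set.univ := by
  exact @PMF.support_uniformOfFintype α (Fintype.ofFinite α) _

theorem uniform_map_apply {α β : Type} [Fintype α] [Nonempty α] (f : α → β) (b : β) :
    (uniform α).map f b = Nat.card {a // f a = b} * (Fintype.card α : ℝ≥0∞)⁻¹ := by
  classical
  rw [PMF.map_apply, tsum_fintype]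
  simp only [uniform_apply]
  rw [← Finset.sum_filter, Finset.sum_const, nsmul_eq_mul, Nat.card_eq_fintype_card,
    Fintype.card_subtype]
  simp only [eq_comm]

end DiscreteProbability

end PIR

namespace PIR

/-! ### Upper bound on the rate -/

section Converse

/-- If, within `B`, each coordinate is determined by at most `M` others, then all coordinates are
determined by those outside some set `D` of `⌈K / (M + 1)⌉` indices. -/
theorem exists_determined_indices {E : Type} {K M : ℕ} (B : Set (Fin K → E))
    (hB : ∀ w, ∃ S : Finset (Fin K), S.card ≤ M ∧ w ∉ S ∧
      ∀ X ∈ B, ∀ X' ∈ B, (∀ i ∈ S, X i = X' i) → X w = X' w) :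
    ∃ D : Finset (Fin K), D.card = ⌈(K : ℚ) / ((M : ℚ) + 1)⌉₊ ∧
      ∀ X ∈ B, ∀ X' ∈ B, (∀ i ∉ D, X i = X' i) → X = X' := by
  classical
  -- Greedy invariant: on `B`, the coordinates in `T \ D` determine all of `T`. Each round adds a
  -- new `w` and its `S`, at most `M + 1` indices, so `T` cannot exhaust `Fin K` before the last
  -- round.
  have key : ∀ m ≤ ⌈(K : ℚ) / ((M : ℚ) + 1)⌉₊, ∃ D T : Finset (Fin K), D ⊆ T ∧ D.card = m ∧
      T.card ≤ m * (M + 1) ∧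
      ∀ X ∈ B, ∀ X' ∈ B, (∀ i ∈ T \ D, X i = X' i) → ∀ i ∈ T, X i = X' i := by
    intro m
    induction m with
    | zero => exact fun _ => ⟨∅, ∅, by simp⟩
    | succ m ih =>
      intro hm
      obtain ⟨D, T, hDT, hD, hT, hdet⟩ := ih (by omega)
      have hlt : m * (M + 1) < K := by
        have h1 : (m : ℚ) < K / (M + 1) := Nat.lt_ceil.1 hm
        rw [lt_div_iff₀ (by positivity)] at h1
        exact_mod_cast h1
      obtain ⟨w, hw⟩ : ∃ w, w ∉ T := by
        by_contra! hall
        rw [Finset.eq_univ_iff_forall.2 hall, Finset.card_univ, Fintype.card_fin] at hT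
        omega
      obtain ⟨S, hS, hwS, hSdet⟩ := hB w
      refine ⟨insert w D, insert w (T ∪ S), ?_, ?_, ?_, ?_⟩
      · exact Finset.insert_subset_insert _ (hDT.trans Finset.subset_union_left)
      · rw [Finset.card_insert_of_notMem fun h => hw (hDT h), hD]
      · have h1 := Finset.card_insert_le w (T ∪ S)
        have h2 := Finset.card_union_le T S
        have h3 : (m + 1) * (M + 1) = m * (M + 1) + (M + 1) := by ring
        omega
      · intro X hX X' hX' hag
        have hTag := hdet X hX X' hX' fun i hi => hag i (by
          simp only [Finset.mem_sdiff, Finset.mem_insert, Finset.mem_union] at hi ⊢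
          refine ⟨.inr (.inl hi.1), ?_⟩
          rintro (rfl | h)
          exacts [hw hi.1, hi.2 h])
        -- `S` may meet `D`, but those coordinates are already determined through `T`.
        have hSag : ∀ i ∈ S, X i = X' i := by
          intro i hi
          by_cases hiD : i ∈ D
          · exact hTag i (hDT hiD)
          · refine hag i ?_
            simp only [Finset.mem_sdiff, Finset.mem_insert, Finset.mem_union]
            refine ⟨.inr (.inr hi), ?_⟩
            rintro (rfl | h)
            exacts [hwS hi, hiD h]
        intro i hi
        simp only [Finset.mem_insert, Finset.mem_union] at hi
        rcases hi with rfl | hi | hi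
        exacts [hSdet X hX X' hX' hSag, hTag i hi, hSag i hi]
  obtain ⟨D, T, hDT, hD, -, hdet⟩ := key _ le_rfl
  refine ⟨D, hD, fun X hX X' hX' hag => funext fun i => ?_⟩
  by_cases hi : i ∈ T
  · exact hdet X hX X' hX' (fun j hj => hag j (Finset.mem_sdiff.1 hj).2) i hi
  · exact hag i fun h => hi (hDT h)

/-- If each coordinate is determined by the value of `f` and at most `M` other coordinates, then
every value of `f` has probability at most `|E| ^ (-⌈K / (M + 1)⌉)` on uniform input. -/
theorem uniform_map_apply_le {E A : Type} [Finite E] [Nonempty E] {K M : ℕ} (f : (Fin K → E) → A)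
    (hf : ∀ w, ∃ S : Finset (Fin K), S.card ≤ M ∧ w ∉ S ∧
      ∀ X X', f X = f X' → (∀ i ∈ S, X i = X' i) → X w = X' w) (a : A) :
    (uniform (Fin K → E)).map f a ≤
      ENNReal.ofReal ((Nat.card E : ℝ) ^ ⌈(K : ℚ) / ((M : ℚ) + 1)⌉₊)⁻¹ := by
  classical
  have := Fintype.ofFinite E
  obtain ⟨D, hD, hdet⟩ := exists_determined_indices (M := M) {X | f X = a} fun w => by
    obtain ⟨S, hS, hw, h⟩ := hf w
    exact ⟨S, hS, hw, fun X hX X' hX' => h X X' (Eq.trans hX (Eq.symm hX'))⟩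
  have hDK : D.card ≤ K := by simpa using Finset.card_le_univ D
  rw [← hD, Nat.card_eq_fintype_card]
  -- Restriction to the complement of `D` is injective on a fibre of `f`.
  have hcard : Nat.card {X // f X = a} ≤ Fintype.card E ^ (K - D.card) := by
    have hinj : Function.Injective
        (fun (X : {X // f X = a}) (i : {i // i ∉ D}) => X.1 i.1) := fun X X' h =>
      Subtype.ext (hdet X.1 X.2 X'.1 X'.2 fun i hi => congrFun h ⟨i, hi⟩)
    have := Nat.card_le_card_of_injective _ hinj
    rwa [Nat.card_fun, Nat.card_eq_fintype_card (α := E),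
      Nat.card_eq_fintype_card (α := {i // i ∉ D}),
      Fintype.card_subtype_compl, Fintype.card_fin, Fintype.card_coe] at this
  have hE : (0 : ℝ) < Fintype.card E := by exact_mod_cast Fintype.card_pos
  rw [uniform_map_apply, Fintype.card_fun, Fintype.card_fin]
  rw [← div_eq_mul_inv]
  refine ENNReal.div_le_of_le_mul ?_
  have h1 : ((Fintype.card E ^ K : ℕ) : ℝ≥0∞) = ENNReal.ofReal ((Fintype.card E : ℝ) ^ K) := by
    rw [← ENNReal.ofReal_natCast, Nat.cast_pow]
  rw [h1, ← ENNReal.ofReal_mul (by positivity), ← ENNReal.ofReal_natCast]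
  refine ENNReal.ofReal_le_ofReal ?_
  rw [← div_eq_inv_mul, div_eq_mul_inv, ← pow_sub₀ _ hE.ne' hDK]
  exact_mod_cast hcard

theorem sideInfo_congr {F E : Type} [Field F] [Field E] [Algebra F E] {K M : ℕ}
    (S : Support K M) (C : Coeffs F M) {X X' : Fin K → E} (h : ∀ i ∈ S.1, X i = X' i) :
    sideInfo S C X = sideInfo S C X' :=
  Finset.sum_congr rfl fun j _ => by rw [h _ (Finset.orderEmbOfFin_mem S.1 S.2 j)]

namespace Protocol

theorem finrank_mul_logb_eq {F E : Type} [Field F] [Field E] [Finite E] [Algebra F E] :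
    (Module.finrank F E : ℝ) * Real.logb 2 (Nat.card F) = Real.logb 2 (Nat.card E) := by
  rw [Module.natCard_eq_pow_finrank (K := F) (V := E), Nat.cast_pow, Real.logb_pow]

variable {F E : Type} [Field F] [Finite F] [Field E] [Finite E] {K M : ℕ}

theorem mem_support_law (P : Protocol F E K M) (h : M < K) (ω : Outcome F E K M P.Query) :
    ω ∈ (P.law h).support ↔ ω.W ∉ ω.S.1 ∧ ω.Q ∈ (P.query ω.W ω.S ω.C).support := by
  obtain ⟨W, S, C, Q, X⟩ := ω
  simp only [law, PMF.mem_support_bind_iff, support_uniform, Set.mem_univ, true_and,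
    PMF.mem_support_uniformOfFinset_iff, Finset.mem_compl, PMF.mem_support_pure_iff,
    Outcome.mk.injEq]
  constructor
  · rintro ⟨S', C', W', hW, Q', hQ, X', rfl, rfl, rfl, rfl, rfl⟩
    exact ⟨hW, hQ⟩
  · rintro ⟨hW, hQ⟩
    exact ⟨S, C, W, hW, Q, hQ, X, rfl, rfl, rfl, rfl, rfl⟩

/-- The messages have full support whatever the query, so zero conditional entropy constrains every
pair `X`, `X'`. -/
theorem recoverable_iff [Algebra F E] (P : Protocol F E K M) (h : M < K) :
    P.Recoverable h ↔ ∀ (w : Fin K) (S : Support K M) (C : Coeffs F M), w ∉ S.1 →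
      ∀ q ∈ (P.query w S C).support, ∀ X X' : Fin K → E, P.answer q X = P.answer q X' →
        sideInfo S C X = sideInfo S C X' → X w = X' w := by
  rw [Recoverable, condEntropy_eq_zero_iff]
  constructor
  · intro hrec w S C hw q hq X X' hA hY
    refine hrec ⟨w, S, C, q, X⟩ ((P.mem_support_law h _).2 ⟨hw, hq⟩) ⟨w, S, C, q, X'⟩
      ((P.mem_support_law h _).2 ⟨hw, hq⟩) ?_
    simp only [hA, hY]
  · rintro hdet ⟨w, S, C, q, X⟩ hω ⟨w', S', C', q', X'⟩ - hV
    simp only [Prod.mk.injEq] at hV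
    obtain ⟨hA, rfl, hY, rfl, rfl, rfl⟩ := hV
    obtain ⟨hw, hq⟩ := (P.mem_support_law h _).1 hω
    exact hdet w S C hw q hq X X' hA hY

/-- The only consequence of privacy that the converse needs: `w'` has positive prior probability,
since some support avoids it, hence positive probability given `q`. -/
theorem WPrivate.exists_query {P : Protocol F E K M} {h : M < K} (hP : P.WPrivate h)
    {w : Fin K} {S : Support K M} {C : Coeffs F M} (hw : w ∉ S.1) {q : P.Query}
    (hq : q ∈ (P.query w S C).support) (w' : Fin K) :
    ∃ (S' : Support K M) (C' : Coeffs F M), w' ∉ S'.1 ∧ q ∈ (P.query w' S' C').support := by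
  have hqs : q ∈ ((P.law h).map Outcome.Q).support :=
    (PMF.mem_support_map_iff _ _ _).2
      ⟨⟨w, S, C, q, 0⟩, (P.mem_support_law h _).2 ⟨hw, hq⟩, rfl⟩
  obtain ⟨S₁, hS₁, hcard⟩ := Finset.exists_subset_card_eq
    (s := (Finset.univ : Finset (Fin K)).erase w') (n := M) (by simp; omega)
  have hw₁ : w' ∉ S₁ := fun hmem => by simpa using hS₁ hmem
  obtain ⟨q₁, hq₁⟩ := (P.query w' ⟨S₁, hcard⟩ 1).support_nonempty
  have hW : (P.law h).map Outcome.W w' ≠ 0 :=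
    (PMF.mem_support_iff _ _).1 ((PMF.mem_support_map_iff _ _ _).2
      ⟨⟨w', ⟨S₁, hcard⟩, 1, q₁, 0⟩, (P.mem_support_law h _).2 ⟨hw₁, hq₁⟩, rfl⟩)
  rw [← hP q hqs w'] at hW
  have hj := (ENNReal.div_ne_zero.1 hW).1
  obtain ⟨ω, hω, he⟩ := (PMF.mem_support_map_iff _ _ _).1 ((PMF.mem_support_iff _ _).2 hj)
  simp only [Prod.mk.injEq] at he
  obtain ⟨rfl, rfl⟩ := he
  exact ⟨ω.S, ω.C, (P.mem_support_law h _).1 hω⟩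

variable [Algebra F E]

theorem IsPIRCSI.map_answer_apply_le {P : Protocol F E K M} {h : M < K} (hP : P.IsPIRCSI h)
    (a : P.Answer) :
    (P.law h).map (fun ω => P.answer ω.Q ω.X) a ≤
      ENNReal.ofReal ((Nat.card E : ℝ) ^ ⌈(K : ℚ) / ((M : ℚ) + 1)⌉₊)⁻¹ := by
  simp only [law, PMF.map_bind, PMF.pure_map]
  refine bind_apply_le _ _ _ _ fun S _ => bind_apply_le _ _ _ _ fun C _ =>
    bind_apply_le _ _ _ _ fun w hw => bind_apply_le _ _ _ _ fun q hq => ?_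
  rw [PMF.mem_support_uniformOfFinset_iff, Finset.mem_compl] at hw
  refine uniform_map_apply_le (P.answer q) (fun w' => ?_) a
  obtain ⟨S', C', hw', hq'⟩ := hP.1.exists_query hw hq w'
  exact ⟨S'.1, S'.2.le, hw', fun X X' hA hag =>
    (P.recoverable_iff h).1 hP.2 w' S' C' hw' q hq' X X' hA (sideInfo_congr S' C' hag)⟩

theorem IsPIRCSI.rate_le {P : Protocol F E K M} {h : M < K} (hP : P.IsPIRCSI h) :
    P.rate h ≤ ((⌈(K : ℚ) / ((M : ℚ) + 1)⌉₊ : ℕ) : ℝ≥0∞)⁻¹ := by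
  set n := ⌈(K : ℚ) / ((M : ℚ) + 1)⌉₊
  have hE : (1 : ℝ) < Nat.card E := by exact_mod_cast Finite.one_lt_card
  have hL : 0 < Real.logb 2 (Nat.card E) := Real.logb_pos one_lt_two hE
  have hent := ofReal_logb_le_entropy (P.law h) (fun ω => P.answer ω.Q ω.X)
    (one_le_pow₀ hE.le (n := n)) hP.map_answer_apply_le
  rw [Real.logb_pow, ENNReal.ofReal_mul (by positivity), ENNReal.ofReal_natCast] at hent
  rw [rate, finrank_mul_logb_eq]
  have hL0 := (ENNReal.ofReal_pos.2 hL).ne'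
  calc _ ≤ ENNReal.ofReal (Real.logb 2 (Nat.card E)) /
        (n * ENNReal.ofReal (Real.logb 2 (Nat.card E))) := ENNReal.div_le_div_left hent _
    _ = (n : ℝ≥0∞)⁻¹ := by
        rw [div_eq_mul_inv, ENNReal.mul_inv (.inr ENNReal.ofReal_ne_top) (.inr hL0), mul_comm,
          mul_assoc, ENNReal.inv_mul_cancel hL0 ENNReal.ofReal_ne_top, mul_one]

end Protocol

end Converse

end PIR

namespace PIR

/-! ### The random cover protocol over the field with two elements -/

section Achievability

open Equiv (Perm)

theorem map_eq_sum_map_pair_left {Ω α β : Type} [Fintype α] (p : PMF Ω) (U : Ω → α) (V : Ω → β)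
    (v : β) : p.map V v = ∑ u, p.map (fun ω => (U ω, V ω)) (u, v) := by
  classical
  rw [show V = Prod.snd ∘ fun ω => (U ω, V ω) from rfl, ← PMF.map_comp, PMF.map_apply,
    ENNReal.tsum_prod', tsum_fintype]
  refine Finset.sum_congr rfl fun u _ => ?_
  rw [tsum_eq_single v fun v' hv' => by simp [hv'.symm]]
  simp

theorem map_eq_sum_map_pair_right {Ω α β : Type} [Fintype β] (p : PMF Ω) (U : Ω → α) (V : Ω → β)
    (u : α) : p.map U u = ∑ v, p.map (fun ω => (U ω, V ω)) (u, v) := by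
  classical
  rw [show U = Prod.fst ∘ fun ω => (U ω, V ω) from rfl, ← PMF.map_comp, PMF.map_apply,
    ENNReal.tsum_prod', tsum_eq_single u fun u' hu' => by simp [hu'.symm], tsum_fintype]
  simp

/-- Two finite random variables with constant joint mass function are independent. -/
theorem map_pair_div_map_of_forall_eq {Ω α β : Type} [Fintype α] [Fintype β] (p : PMF Ω)
    (U : Ω → α) (V : Ω → β) {c : ℝ≥0∞} (hc : ∀ u v, p.map (fun ω => (U ω, V ω)) (u, v) = c)
    (u : α) (v : β) :
    p.map (fun ω => (U ω, V ω)) (u, v) / p.map V v = p.map U u := by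
  have hV : ∀ v, p.map V v = Fintype.card α * c := fun v => by
    rw [map_eq_sum_map_pair_left p U]
    simp [hc]
  have hU : p.map U u = Fintype.card β * c := by
    rw [map_eq_sum_map_pair_right p U V]
    simp [hc]
  have htot : Fintype.card β * (Fintype.card α * c) = 1 := by
    rw [← (p.map V).tsum_coe, tsum_fintype]
    simp [hV]
  have hV0 : p.map V v ≠ 0 := by
    rw [hV]
    intro h0
    simp [h0] at htot
  rw [eq_comm, ENNReal.eq_div_iff hV0 (PMF.apply_ne_top _ _), hU, hV, hc]
  refine Eq.symm ?_
  calc c = (Fintype.card β * (Fintype.card α * c)) * c := by rw [htot, one_mul]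
    _ = _ := by ring

theorem bind_map_mk_apply {α β : Type} (p : PMF α) (f : α → PMF β) (a : α) (b : β) :
    (p.bind fun a => (f a).map fun b => (a, b)) (a, b) = p a * f a b := by
  classical
  rw [PMF.bind_apply, tsum_eq_single a fun a' ha' => by simp [PMF.map_apply, ha'.symm],
    PMF.map_apply, tsum_eq_single b fun b' hb' => by simp [hb'.symm], if_pos rfl]

/-- Extend a bijection from `S` to `S'` to a permutation, then swap the image of `w` with `w'`; both
lie outside `S'`, so the swap fixes `S'` pointwise. -/
theorem exists_perm_apply_eq_map_eq {α : Type} [Fintype α] [DecidableEq α] {w w' : α}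
    {S S' : Finset α} (hw : w ∉ S) (hw' : w' ∉ S') (hS : S.card = S'.card) :
    ∃ σ : Perm α, σ w = w' ∧ S.map σ.toEmbedding = S' := by
  let e : {x // x ∈ S} ≃ {x // x ∈ S'} := Finset.equivOfCardEq hS
  have hmem : ∀ x ∈ S, e.extendSubtype x ∈ S' := fun x hx => e.extendSubtype_mem x hx
  have hnot : e.extendSubtype w ∉ S' := e.extendSubtype_not_mem w hw
  refine ⟨Equiv.swap (e.extendSubtype w) w' * e.extendSubtype, by simp, ?_⟩
  refine Finset.eq_of_subset_of_card_le (fun y hy => ?_) (by rw [Finset.card_map, hS])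
  obtain ⟨x, hx, rfl⟩ := Finset.mem_map.1 hy
  have h1 := hmem x hx
  simp only [Equiv.coe_toEmbedding, Equiv.Perm.coe_mul, Function.comp_apply]
  rwa [Equiv.swap_apply_of_ne_of_ne (ne_of_mem_of_not_mem h1 hnot) (ne_of_mem_of_not_mem h1 hw')]

/-- `Fin K` is covered by `n` subsets of size `M + 1` as soon as `K ≤ n * (M + 1)`. -/
theorem exists_cover {K M n : ℕ} (h : M < K) (hn : K ≤ n * (M + 1)) :
    ∃ (B : Fin n → Finset (Fin K)) (b : Fin K → Fin n),
      (∀ j, (B j).card = M + 1) ∧ ∀ i, i ∈ B (b i) := by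
  -- Blocks of consecutive indices; a short block is padded to size `M + 1`, which is possible since
  -- `M + 1 ≤ K`.
  have hB : ∀ j : Fin n, ∃ T : Finset (Fin K),
      (Finset.univ.filter fun i : Fin K => (i : ℕ) / (M + 1) = j) ⊆ T ∧ T.card = M + 1 := by
    intro j
    have hle : (Finset.univ.filter fun i : Fin K => (i : ℕ) / (M + 1) = j).card ≤ M + 1 := by
      refine (Finset.card_le_card_of_injOn (t := Finset.range (M + 1))
        (fun i : Fin K => (i : ℕ) % (M + 1))
        (fun i _ => Finset.mem_coe.2 (Finset.mem_range.2 (Nat.mod_lt _ M.succ_pos)))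
        (fun i hi i' hi' he => ?_)).trans (Finset.card_range _).le
      simp only [Finset.coe_filter, Finset.mem_univ, true_and, Set.mem_ofPred_eq] at hi hi' he
      refine Fin.ext ?_
      rw [← Nat.div_add_mod (i : ℕ) (M + 1), ← Nat.div_add_mod (i' : ℕ) (M + 1), hi, hi', he]
    obtain ⟨T, h1, -, h2⟩ := Finset.exists_subsuperset_card_eq
      (Finset.subset_univ _) hle (by rw [Finset.card_univ, Fintype.card_fin]; exact h)
    exact ⟨T, h1, h2⟩
  choose B hsub hcard using hB
  refine ⟨B, fun i => ⟨i / (M + 1), ?_⟩, hcard, fun i => hsub _ (by simp)⟩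
  exact (Nat.div_lt_iff_lt_mul M.succ_pos).2 (i.2.trans_le hn)

variable {K M n : ℕ} (B : Fin n → Finset (Fin K)) (b : Fin K → Fin n)

/-- The relabellings `π` for which the set assigned to the demand `w` becomes `{w} ∪ S`. -/
def compatiblePerms (w : Fin K) (S : Finset (Fin K)) : Finset (Perm (Fin K)) :=
  Finset.univ.filter fun π => ((B (b (π.symm w))).map π.toEmbedding).erase w = S

theorem mem_compatiblePerms {w : Fin K} {S : Finset (Fin K)} {π : Perm (Fin K)} :
    π ∈ compatiblePerms B b w S ↔ ((B (b (π.symm w))).map π.toEmbedding).erase w = S := by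
  simp [compatiblePerms]

/-- Left multiplication by a permutation taking `(w, S)` to `(w', S')` preserves compatibility. Used
in both directions, this gives equality. -/
theorem card_compatiblePerms_le {w w' : Fin K} {S S' : Finset (Fin K)} (hw : w ∉ S)
    (hw' : w' ∉ S') (hS : S.card = S'.card) :
    (compatiblePerms B b w S).card ≤ (compatiblePerms B b w' S').card := by
  obtain ⟨σ, rfl, rfl⟩ := exists_perm_apply_eq_map_eq hw hw' hS
  refine Finset.card_le_card_of_injOn (fun π => σ * π) (fun π hπ => ?_)
    (fun π _ π' _ h => mul_left_cancel h)
  rw [Finset.mem_coe, mem_compatiblePerms] at hπ ⊢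
  rw [← hπ, Finset.map_erase, Finset.map_map]
  have : (σ * π).symm (σ w) = π.symm w := by
    rw [Equiv.symm_apply_eq]
    simp
  rw [this]
  rfl

variable {B b}

theorem compatiblePerms_nonempty (hB : ∀ j, (B j).card = M + 1) (hb : ∀ i, i ∈ B (b i))
    {w : Fin K} {S : Finset (Fin K)} (hw : w ∉ S) (hS : S.card = M) :
    (compatiblePerms B b w S).Nonempty := by
  obtain ⟨π, hπw, hπ⟩ := exists_perm_apply_eq_map_eq (S := (B (b w)).erase w)
    (Finset.notMem_erase w _) hw (by rw [Finset.card_erase_of_mem (hb w), hB, hS]; rfl)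
  refine ⟨π, (mem_compatiblePerms B b).2 ?_⟩
  rw [Finset.map_erase] at hπ
  have : π.symm w = w := by rw [Equiv.symm_apply_eq, hπw]
  rw [this, ← hπ]
  congr 1
  exact hπw.symm

variable (B b)

/-- The law of a uniformly random relabelling compatible with the demand and the support. -/
noncomputable def coverQuery (w : Fin K) (S : Finset (Fin K)) : PMF (Perm (Fin K)) :=
  -- The default `1` is immaterial: for a genuine cover, `w ∉ S` and `S.card = M` ensure
  -- nonemptiness.
  if h : (compatiblePerms B b w S).Nonempty then PMF.uniformOfFinset _ h else PMF.pure 1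

/-- The user sends a random relabelling of the cover `B` in which the demand and the support of the
side information together form the set assigned to the demand; the server answers with the sums of
the messages over the relabelled sets. -/
noncomputable def coverProtocol (M : ℕ) : Protocol (ZMod 2) (ZMod 2) K M where
  Query := Perm (Fin K)
  Answer := Fin n → ZMod 2
  query w S _ := coverQuery B b w S.1
  answer π X j := ∑ i ∈ (B j).map π.toEmbedding, X i

theorem scalarLinear_coverProtocol : (coverProtocol B b M).ScalarLinear := by
  classical
  refine ⟨List.ofFn, fun a _ a' _ h => List.ofFn_injective h, fun π =>
    ⟨List.ofFn fun j i => if i ∈ (B j).map π.toEmbedding then 1 else 0, fun X => ?_⟩⟩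
  rw [List.map_ofFn]
  refine congrArg List.ofFn (funext fun j => ?_)
  simp only [coverProtocol, Function.comp_apply, smul_eq_mul, ite_mul, one_mul, zero_mul]
  rw [← Finset.sum_filter, Finset.filter_univ_mem]

theorem sideInfo_zmod_two (S : Support K M) (C : Coeffs (ZMod 2) M) (X : Fin K → ZMod 2) :
    sideInfo S C X = ∑ i ∈ S.1, X i := by
  have hC : ∀ j, ((C j : (ZMod 2)ˣ) : ZMod 2) = 1 := fun j => by
    rw [Subsingleton.elim (C j) 1, Units.val_one]
  simp only [sideInfo, hC, one_smul]
  conv_rhs => rw [← Finset.map_orderEmbOfFin_univ S.1 S.2, Finset.sum_map]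
  rfl

variable {B b}

theorem coverQuery_eq (hB : ∀ j, (B j).card = M + 1) (hb : ∀ i, i ∈ B (b i)) {w : Fin K}
    {S : Finset (Fin K)} (hw : w ∉ S) (hS : S.card = M) :
    coverQuery B b w S = PMF.uniformOfFinset _ (compatiblePerms_nonempty hB hb hw hS) :=
  dif_pos _

/-- The sum over the set assigned to `w` equals `X w` plus the side information. -/
theorem recoverable_coverProtocol (h : M < K) (hB : ∀ j, (B j).card = M + 1)
    (hb : ∀ i, i ∈ B (b i)) : (coverProtocol B b M).Recoverable h := by
  rw [Protocol.recoverable_iff]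
  intro w S C hw (π : Perm (Fin K)) hπ X X' hA hY
  change π ∈ (coverQuery B b w S.1).support at hπ
  rw [coverQuery_eq hB hb hw S.2, PMF.mem_support_uniformOfFinset_iff,
    mem_compatiblePerms] at hπ
  have hwT : w ∈ (B (b (π.symm w))).map π.toEmbedding :=
    Finset.mem_map.2 ⟨π.symm w, hb _, by simp⟩
  have hsum : ∑ i ∈ (B (b (π.symm w))).map π.toEmbedding, X i =
      ∑ i ∈ (B (b (π.symm w))).map π.toEmbedding, X' i := congrFun hA (b (π.symm w))
  rw [← Finset.add_sum_erase _ _ hwT, ← Finset.add_sum_erase _ _ hwT, hπ,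
    ← sideInfo_zmod_two S C, ← sideInfo_zmod_two S C, hY] at hsum
  exact add_right_cancel hsum

theorem wPrivate_coverProtocol (h : M < K) (hB : ∀ j, (B j).card = M + 1)
    (hb : ∀ i, i ∈ B (b i)) : (coverProtocol B b M).WPrivate h := by
  classical
  obtain ⟨S₁⟩ := support_nonempty h
  obtain ⟨w₁, hw₁⟩ := compl_nonempty h S₁
  rw [Finset.mem_compl] at hw₁
  have := support_nonempty h
  rintro q - w
  have : Fintype (coverProtocol B b M).Query := inferInstanceAs (Fintype (Perm (Fin K)))
  -- The factors of `c` are the probabilities of the support, of the demand given the support, and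
  -- of the relabelling given both. The pair `(w₁, S₁)` is only a reference point for the constant
  -- count.
  refine map_pair_div_map_of_forall_eq ((coverProtocol B b M).law h) Outcome.W Outcome.Q
    (c := (Fintype.card (Support K M) : ℝ≥0∞)⁻¹ *
      (((K - M : ℕ) : ℝ≥0∞)⁻¹ * ((compatiblePerms B b w₁ S₁.1).card : ℝ≥0∞)⁻¹)) ?_ w q
  clear w q
  intro w (π : Perm (Fin K))
  have hjoint : ((coverProtocol B b M).law h).map (fun ω => (ω.W, ω.Q)) =
      (uniform (Support K M)).bind fun S =>
        (PMF.uniformOfFinset (S.1ᶜ) (compl_nonempty h S)).bind fun W =>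
          (coverQuery B b W S.1).map fun π => (W, π) := by
    simp only [Protocol.law, PMF.map_bind, PMF.pure_map, PMF.bind_const]
    exact congrArg _ (funext fun S => PMF.bind_const (uniform (Coeffs (ZMod 2) M))
      ((PMF.uniformOfFinset (S.1ᶜ) (compl_nonempty h S)).bind fun W =>
        (coverQuery B b W S.1).map fun π => (W, π)))
  have hwT : w ∈ (B (b (π.symm w))).map π.toEmbedding :=
    Finset.mem_map.2 ⟨π.symm w, hb _, by simp⟩
  -- The unique support compatible with `w` and `π`; all other terms of the sum over supports
  -- vanish.
  let S₀ : Support K M := ⟨((B (b (π.symm w))).map π.toEmbedding).erase w, by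
    rw [Finset.card_erase_of_mem hwT, Finset.card_map, hB]; rfl⟩
  have hwS₀ : w ∉ S₀.1 := Finset.notMem_erase w _
  have hquery : ∀ S : Support K M, w ∉ S.1 → coverQuery B b w S.1 π =
      if S = S₀ then ((compatiblePerms B b w₁ S₁.1).card : ℝ≥0∞)⁻¹ else 0 := by
    intro S hw
    have hcard : (compatiblePerms B b w S.1).card = (compatiblePerms B b w₁ S₁.1).card :=
      le_antisymm (card_compatiblePerms_le B b hw hw₁ (S.2.trans S₁.2.symm))
        (card_compatiblePerms_le B b hw₁ hw (S₁.2.trans S.2.symm))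
    have hiff : π ∈ compatiblePerms B b w S.1 ↔ S = S₀ := by
      rw [mem_compatiblePerms, Subtype.ext_iff, eq_comm]
    rw [coverQuery_eq hB hb hw S.2, PMF.uniformOfFinset_apply]
    simp only [hiff, hcard]
  have hinner : ∀ S : Support K M,
      ((PMF.uniformOfFinset (S.1ᶜ) (compl_nonempty h S)).bind fun W =>
        (coverQuery B b W S.1).map fun π => (W, π)) (w, π) =
      if S = S₀ then ((K - M : ℕ) : ℝ≥0∞)⁻¹ * ((compatiblePerms B b w₁ S₁.1).card : ℝ≥0∞)⁻¹
      else 0 := by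
    intro S
    rw [bind_map_mk_apply, PMF.uniformOfFinset_apply]
    by_cases hw : w ∈ S.1
    · rw [if_neg (by simpa using hw), zero_mul, if_neg]
      rintro rfl
      exact hwS₀ hw
    · rw [if_pos (by simpa using hw), hquery S hw, mul_ite, mul_zero, Finset.card_compl, S.2,
        Fintype.card_fin]
  refine (DFunLike.congr_fun hjoint (w, π)).trans ((PMF.bind_apply _ _ _).trans ?_)
  refine (tsum_eq_single S₀ fun S hS => ?_).trans ?_
  · exact mul_eq_zero_of_right _ ((hinner S).trans (if_neg hS))
  · exact congrArg₂ _ (uniform_apply S₀) ((hinner S₀).trans (if_pos rfl))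

variable (B b)

theorem rate_coverProtocol_ge (h : M < K) :
    (n : ℝ≥0∞)⁻¹ ≤ (coverProtocol B b M).rate h := by
  have : Fintype (coverProtocol B b M).Answer := inferInstanceAs (Fintype (Fin n → ZMod 2))
  have : Nonempty (coverProtocol B b M).Answer := inferInstanceAs (Nonempty (Fin n → ZMod 2))
  have hent := entropy_le_logb_card ((coverProtocol B b M).law h)
    fun ω => (coverProtocol B b M).answer ω.Q ω.X
  have hcard : Fintype.card (coverProtocol B b M).Answer = 2 ^ n := by
    rw [← Nat.card_eq_fintype_card]
    change Nat.card (Fin n → ZMod 2) = _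
    simp
  rw [hcard, Nat.cast_pow, Real.logb_pow, Nat.cast_ofNat, Real.logb_self_eq_one one_lt_two,
    mul_one, ENNReal.ofReal_natCast] at hent
  rw [Protocol.rate, Protocol.finrank_mul_logb_eq, Nat.card_zmod, Nat.cast_ofNat,
    Real.logb_self_eq_one one_lt_two, ENNReal.ofReal_one, one_div]
  exact ENNReal.inv_le_inv.2 hent

end Achievability

end PIR

theorem theorem3 (K M : ℕ) (hM : 1 ≤ M) (hMK : M < K) :
    PIR.capacity hMK = ((⌈(K : ℚ) / ((M : ℚ) + 1)⌉₊ : ℕ) : ENNReal)⁻¹ ∧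
    PIR.scalarLinearCapacity hMK = ((⌈(K : ℚ) / ((M : ℚ) + 1)⌉₊ : ℕ) : ENNReal)⁻¹ := by
  have hcover : K ≤ ⌈(K : ℚ) / ((M : ℚ) + 1)⌉₊ * (M + 1) := by
    have h1 := Nat.le_ceil ((K : ℚ) / ((M : ℚ) + 1))
    rw [div_le_iff₀ (by positivity)] at h1
    exact_mod_cast h1
  obtain ⟨B, b, hB, hb⟩ := PIR.exists_cover hMK hcover
  have hpir : (PIR.coverProtocol B b M).IsPIRCSI hMK :=
    ⟨PIR.wPrivate_coverProtocol hMK hB hb, PIR.recoverable_coverProtocol hMK hB hb⟩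
  constructor
  · refine le_antisymm (sSup_le ?_) ((PIR.rate_coverProtocol_ge B b hMK).trans (le_sSup ?_))
    · rintro r ⟨F, E, _, _, _, _, _, P, hP, rfl⟩
      exact hP.rate_le
    · exact ⟨ZMod 2, ZMod 2, _, inferInstance, _, inferInstance, inferInstance, _, hpir, rfl⟩
  · refine le_antisymm (sSup_le ?_) ((PIR.rate_coverProtocol_ge B b hMK).trans (le_sSup ?_))
    · rintro r ⟨F, E, _, _, _, _, _, P, hP, -, rfl⟩
      exact hP.rate_le
    · exact ⟨ZMod 2, ZMod 2, _, inferInstance, _, inferInstance, inferInstance, _, hpir,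
        PIR.scalarLinear_coverProtocol B b, rfl⟩
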